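/- There is a universal constant $C_{\mathrm{anti}}$ with $1.2 < C_{\mathrm{anti}} < \infty$ such that the following holds. Let $x_1,\dots,x_n$ be independent real random variables, each of which has mean zero, is supported on $[-2,2]$, and has a probability density function (with respect to Lebesgue measure) bounded by $1$. Let $c_1,\dots,c_n\in\mathbb{R}$ and $L = c_1x_1+\cdots+c_nx_n$. Then for every $0<\varepsilon<1/2$, $$\Pr\bigl[\,|L-1|\le\varepsilon\,\bigr]\;\le\; C_{\mathrm{anti}}\,\varepsilon\,\sqrt{\log_2(1/\varepsilon)}.$$ -/

import Mathlib

open MeasureTheory ProbabilityTheory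

/-- A real random variable is nice if it has mean zero, is (almost surely) supported on `[-2, 2]`,
and has a probability density with respect to Lebesgue measure that is bounded by `1`
(almost everywhere, densities being determined only up to null sets). -/
structure IsNice {Ω : Type*} [MeasurableSpace Ω] (X : Ω → ℝ) (μ : Measure Ω) : Prop where
  /-- `X` is a.e. measurable and its law is absolutely continuous. -/
  hasPDF : HasPDF X μ volume
  pdf_le_one : ∀ᵐ t ∂(volume : Measure ℝ), pdf X μ volume t ≤ 1
  mem_Icc : ∀ᵐ ω ∂μ, X ω ∈ Set.Icc (-2 : ℝ) 2
  mean_zero : ∫ ω, X ω ∂μ = 0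

/-!
The probability in question is small for one of two reasons, according to the size of the `ℓ²` norm
`s` of the coefficients.

If `s ^ 2 ≤ 1 / (32 * log (1 / ε))`, then `L` is sub-Gaussian with variance proxy `4 * s ^ 2`, and
Hoeffding's inequality already gives `P (L ≥ 1 / 2) ≤ ε` (`measureReal_abs_sum_sub_one_le`).

Otherwise `1 / s` is at most a constant times `√(log (1 / ε))`, and it is enough to show that every
interval of radius `ε` has probability `O(ε / s)` (`measure_abs_sum_sub_le`). A single coefficient
larger than `s / √2` gives this by conditioning on the other summands. If there is none, Fourier
analysis applies: the probability is at most `ε * ∫ |φ_L|` (`measure_abs_sub_le_lintegral_charFun`),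
the function `φ_L` is the product of the `φ_i (c i * t)`, and Hölder's inequality with exponents
`s ^ 2 / c i ^ 2` reduces the claim to `∫ |φ_i| ^ p = O(1 / √p)` for `p ≥ 2`
(`lintegral_sq_norm_charFun_rpow_le`), as in K. Ball's proof of cube slicing.

For this last bound set `ψ = |φ_i| ^ 2`, the characteristic function of the difference of two
independent copies. Plancherel gives `∫ ψ ≤ 2 * π`. Since `1 - cos (k * a) ≤ k ^ 2 * (1 - cos a)`,
also `1 - ψ (k * t) ≤ k ^ 2 * (1 - ψ t)`: a value of `ψ` near `1` away from the origin would be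
repeated at many multiples, which contradicts `∫ ψ ≤ 2 * π`, and the same inequality carries the
resulting gap down to a quadratic one near the origin. Hence `ψ ^ q` is dominated by a Gaussian of
width of order `1 / √q` plus an exponentially small multiple of `ψ`.
-/

open scoped ENNReal NNReal Real

open Filter Topology

/-! ### Trigonometric inequalities -/

theorem abs_sin_nat_mul_le (k : ℕ) (a : ℝ) : |Real.sin (k * a)| ≤ k * |Real.sin a| := by
  induction k with
  | zero => simp
  | succ k ih =>
    have h1 : ((k + 1 : ℕ) : ℝ) * a = k * a + a := by push_cast; ring
    rw [h1, Real.sin_add]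
    have h2 : |Real.sin (k * a) * Real.cos a| ≤ |Real.sin (k * a)| := by
      rw [abs_mul]; exact mul_le_of_le_one_right (abs_nonneg _) (Real.abs_cos_le_one _)
    have h3 : |Real.cos (k * a) * Real.sin a| ≤ |Real.sin a| := by
      rw [abs_mul]; exact mul_le_of_le_one_left (abs_nonneg _) (Real.abs_cos_le_one _)
    refine (abs_add_le _ _).trans ?_
    push_cast
    linarith

theorem one_sub_cos_nat_mul_le (k : ℕ) (a : ℝ) :
    1 - Real.cos (k * a) ≤ k ^ 2 * (1 - Real.cos a) := by
  have key : ∀ b : ℝ, 1 - Real.cos b = 2 * |Real.sin (b / 2)| ^ 2 := fun b ↦ by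
    have := Real.cos_sq (b / 2)
    rw [sq_abs, Real.sin_sq, this]; ring_nf
  rw [key, key, mul_div_assoc]
  have := pow_le_pow_left₀ (abs_nonneg _) (abs_sin_nat_mul_le k (a / 2)) 2
  rw [mul_pow] at this
  linarith

/-! ### Symmetrization and squared moduli of characteristic functions -/

/-- The law of `X - X'` for independent `X`, `X'` of law `ν`. -/
noncomputable def symmetrization (ν : Measure ℝ) : Measure ℝ := ν ∗ ν.map (-1 * ·)

section Symmetrization

variable (ν : Measure ℝ) [IsProbabilityMeasure ν]

instance : IsProbabilityMeasure (symmetrization ν) := by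
  have : IsProbabilityMeasure (ν.map (-1 * ·)) :=
    Measure.isProbabilityMeasure_map (by fun_prop)
  unfold symmetrization
  infer_instance

theorem charFun_symmetrization (t : ℝ) :
    charFun (symmetrization ν) t = ((‖charFun ν t‖ ^ 2 : ℝ) : ℂ) := by
  have : IsProbabilityMeasure (ν.map (-1 * ·)) :=
    Measure.isProbabilityMeasure_map (by fun_prop)
  rw [symmetrization, charFun_conv, charFun_map_mul, neg_one_mul, charFun_neg, Complex.mul_conj,
    Complex.normSq_eq_norm_sq]

theorem sq_norm_charFun_eq_integral_cos (t : ℝ) :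
    ‖charFun ν t‖ ^ 2 = ∫ y, Real.cos (t * y) ∂symmetrization ν := by
  have h := congrArg Complex.re (charFun_symmetrization ν t)
  rw [Complex.ofReal_re, charFun_apply_real] at h
  rw [← h]
  have hi : Integrable (fun y : ℝ ↦ Complex.exp (t * y * Complex.I)) (symmetrization ν) := by
    refine Integrable.of_bound (by fun_prop) 1 (ae_of_all _ fun y ↦ ?_)
    rw [← Complex.ofReal_mul, Complex.norm_exp_ofReal_mul_I]
  have := integral_re (𝕜 := ℂ) hi
  simp only [RCLike.re_to_complex] at this
  rw [← this]
  congr 1 with y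
  rw [← Complex.ofReal_mul, Complex.exp_ofReal_mul_I_re]

theorem integrable_cos_mul (ρ : Measure ℝ) [IsFiniteMeasure ρ] (t : ℝ) :
    Integrable (fun y ↦ Real.cos (t * y)) ρ :=
  Integrable.of_bound (by fun_prop) 1 (ae_of_all _ fun y ↦ by simpa using Real.abs_cos_le_one _)

theorem one_sub_sq_norm_charFun (t : ℝ) :
    1 - ‖charFun ν t‖ ^ 2 = ∫ y, (1 - Real.cos (t * y)) ∂symmetrization ν := by
  rw [integral_sub (integrable_const _) (integrable_cos_mul _ t),
    sq_norm_charFun_eq_integral_cos]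
  simp

/-- If the modulus of a characteristic function is close to `1` at `t`, it is still close to `1` at
small integer multiples of `t`. -/
theorem one_sub_sq_norm_charFun_nat_mul_le (k : ℕ) (t : ℝ) :
    1 - ‖charFun ν (k * t)‖ ^ 2 ≤ k ^ 2 * (1 - ‖charFun ν t‖ ^ 2) := by
  rw [one_sub_sq_norm_charFun, one_sub_sq_norm_charFun, ← integral_const_mul]
  refine integral_mono ?_ ?_ fun y ↦ ?_
  · exact (integrable_const _).sub (integrable_cos_mul _ _)
  · exact ((integrable_const _).sub (integrable_cos_mul _ _)).const_mul _
  · simpa [mul_assoc] using one_sub_cos_nat_mul_le k (t * y)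

variable {ν}

theorem ae_abs_le_symmetrization {R : ℝ} (h : ∀ᵐ x ∂ν, |x| ≤ R) :
    ∀ᵐ y ∂symmetrization ν, |y| ≤ 2 * R := by
  have : IsProbabilityMeasure (ν.map (-1 * ·)) :=
    Measure.isProbabilityMeasure_map (by fun_prop)
  have hm : MeasurableSet {y : ℝ | |y| ≤ R} := measurableSet_le (by fun_prop) (by fun_prop)
  have h' : ∀ᵐ x ∂(ν.map (-1 * ·)), |x| ≤ R := by
    rw [ae_map_iff (by fun_prop) hm]
    simpa using h
  have h1 : ∀ᵐ p ∂ν.prod (ν.map (-1 * ·)), |p.1| ≤ R :=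
    Measure.quasiMeasurePreserving_fst.ae h
  have h2 : ∀ᵐ p ∂ν.prod (ν.map (-1 * ·)), |p.2| ≤ R :=
    Measure.quasiMeasurePreserving_snd.ae h'
  rw [symmetrization, Measure.conv,
    ae_map_iff (by fun_prop) (measurableSet_le (by fun_prop) (by fun_prop))]
  filter_upwards [h1, h2] with p hp1 hp2
  refine (abs_add_le _ _).trans ?_
  linarith

theorem symmetrization_le_volume (h : ν ≤ volume) : symmetrization ν ≤ volume := by
  have : IsProbabilityMeasure (ν.map (-1 * ·)) :=
    Measure.isProbabilityMeasure_map (by fun_prop)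
  refine Measure.le_iff.2 fun s hs ↦ ?_
  rw [symmetrization, Measure.conv, Measure.map_apply (by fun_prop) hs,
    Measure.prod_apply_symm (by measurability)]
  calc _ ≤ ∫⁻ _, volume s ∂(ν.map (-1 * ·)) := by
        refine lintegral_mono fun y ↦ (h _).trans_eq ?_
        exact measure_preimage_add_right volume y s
    _ = _ := by simp only [lintegral_const, measure_univ, mul_one]

theorem abs_sq_norm_charFun_sub_le {R : ℝ} (h : ∀ᵐ x ∂ν, |x| ≤ R) (s t : ℝ) :
    |‖charFun ν s‖ ^ 2 - ‖charFun ν t‖ ^ 2| ≤ 2 * R * |s - t| := by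
  rw [sq_norm_charFun_eq_integral_cos, sq_norm_charFun_eq_integral_cos,
    ← integral_sub (integrable_cos_mul _ _) (integrable_cos_mul _ _), ← Real.norm_eq_abs]
  have := norm_integral_le_of_norm_le_const (μ := symmetrization ν)
    (f := fun y ↦ Real.cos (s * y) - Real.cos (t * y)) (C := 2 * R * |s - t|) ?_
  · simpa using this
  · filter_upwards [ae_abs_le_symmetrization h] with y hy
    rw [Real.norm_eq_abs]
    have h1 : |Real.cos (s * y) - Real.cos (t * y)| ≤ |s * y - t * y| := by
      have := Real.lipschitzWith_cos.dist_le_mul (s * y) (t * y)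
      simpa [Real.dist_eq] using this
    refine h1.trans ?_
    rw [← sub_mul, abs_mul, mul_comm]
    gcongr

end Symmetrization

/-! ### Parseval's formula -/

/-- Parseval's formula for characteristic functions. -/
theorem integral_charFun_comm (μ γ : Measure ℝ) [IsFiniteMeasure μ] [IsFiniteMeasure γ] :
    ∫ t, charFun μ t ∂γ = ∫ x, charFun γ x ∂μ := by
  simp_rw [charFun_apply_real]
  rw [integral_integral_swap]
  · congr 1 with x
    congr 1 with t
    ring_nf
  · refine Integrable.of_bound (by fun_prop) 1 (ae_of_all _ fun p ↦ ?_)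
    simp only [Function.uncurry]
    rw [← Complex.ofReal_mul, Complex.norm_exp_ofReal_mul_I]

theorem integral_charFun_gaussianReal (μ : Measure ℝ) [IsFiniteMeasure μ] (v : ℝ≥0) :
    ∫ t, charFun μ t ∂gaussianReal 0 v = ((∫ x, Real.exp (-(v * x ^ 2 / 2)) ∂μ : ℝ) : ℂ) := by
  rw [integral_charFun_comm, ← integral_complex_ofReal]
  congr 1 with x
  rw [charFun_gaussianReal]
  push_cast
  congr 1
  simp

/-! ### Plancherel bound -/

theorem measurable_sq_norm_charFun (ν : Measure ℝ) [IsFiniteMeasure ν] :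
    Measurable fun t ↦ ‖charFun ν t‖ ^ 2 :=
  measurable_charFun.norm.pow_const 2

theorem sq_norm_charFun_le_one (ν : Measure ℝ) [IsProbabilityMeasure ν] (t : ℝ) :
    ‖charFun ν t‖ ^ 2 ≤ 1 :=
  pow_le_one₀ (norm_nonneg _) (norm_charFun_le_one t)

/-- The Plancherel bound with a Gaussian weight. Parseval's formula turns the left side into the
integral of `√(2 * π * v) * exp (-v * x ^ 2 / 2)` against the symmetrization, which is at most
Lebesgue measure. -/
theorem lintegral_sq_norm_charFun_mul_exp_le {ν : Measure ℝ} [IsProbabilityMeasure ν]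
    (h : ν ≤ volume) {v : ℝ≥0} (hv : v ≠ 0) :
    ∫⁻ t, ENNReal.ofReal (‖charFun ν t‖ ^ 2 * Real.exp (-(t ^ 2 / (2 * v)))) ≤
      ENNReal.ofReal (2 * π) := by
  have hv0 : (0 : ℝ) < v := by positivity
  have hψm := measurable_sq_norm_charFun ν
  have hint : Integrable (fun t ↦ ‖charFun ν t‖ ^ 2) (gaussianReal 0 v) :=
    Integrable.of_bound hψm.aestronglyMeasurable 1 (ae_of_all _ fun t ↦ by
      rw [Real.norm_of_nonneg (by positivity)]; exact sq_norm_charFun_le_one ν t)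
  have hexp : Integrable (fun x : ℝ ↦ Real.exp (-(v * x ^ 2 / 2))) volume := by
    have := integrable_exp_neg_mul_sq (b := (v : ℝ) / 2) (by positivity)
    refine this.congr (ae_of_all _ fun x ↦ ?_)
    dsimp only; ring_nf
  have hγ : ∫⁻ t, ENNReal.ofReal (‖charFun ν t‖ ^ 2) ∂gaussianReal 0 v ≤
      ENNReal.ofReal (√(2 * π / v)) := by
    rw [← ofReal_integral_eq_lintegral_ofReal hint (ae_of_all _ fun t ↦ by positivity)]
    refine ENNReal.ofReal_le_ofReal ?_
    have hpars := integral_charFun_gaussianReal (symmetrization ν) v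
    simp_rw [charFun_symmetrization] at hpars
    rw [integral_complex_ofReal, Complex.ofReal_inj] at hpars
    rw [hpars]
    calc _ ≤ ∫ x : ℝ, Real.exp (-(v * x ^ 2 / 2)) :=
          integral_mono_measure (symmetrization_le_volume h)
            (ae_of_all _ fun x ↦ (Real.exp_pos _).le) hexp
      _ = ∫ x : ℝ, Real.exp (-(v / 2) * x ^ 2) := by congr 1 with x; ring_nf
      _ = _ := by rw [integral_gaussian]; congr 1; field_simp
  rw [gaussianReal_of_var_ne_zero _ hv, lintegral_withDensity_eq_lintegral_mul _
    (measurable_gaussianPDF _ _) hψm.ennreal_ofReal] at hγ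
  have hs : 0 < √(2 * π * v) := by positivity
  calc _ = ∫⁻ t, ENNReal.ofReal (√(2 * π * v)) *
        (gaussianPDF 0 v * fun t ↦ ENNReal.ofReal (‖charFun ν t‖ ^ 2)) t := by
        congr 1 with t
        rw [Pi.mul_apply, gaussianPDF, gaussianPDFReal, ← ENNReal.ofReal_mul (by positivity),
          ← ENNReal.ofReal_mul (by positivity)]
        congr 1
        field_simp
        simp
    _ ≤ ENNReal.ofReal (√(2 * π * v)) * ENNReal.ofReal (√(2 * π / v)) := by
        rw [lintegral_const_mul']
        · gcongr
        · exact ENNReal.ofReal_ne_top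
    _ = _ := by
        rw [← ENNReal.ofReal_mul hs.le, ← Real.sqrt_mul (by positivity)]
        congr 1
        rw [show 2 * π * v * (2 * π / v) = (2 * π) ^ 2 by field_simp]
        exact Real.sqrt_sq (by positivity)

/-- The half of Plancherel's theorem that is needed: a probability density bounded by `1` has
squared `L²` norm at most `1`. -/
theorem lintegral_sq_norm_charFun_le {ν : Measure ℝ} [IsProbabilityMeasure ν]
    (h : ν ≤ volume) : ∫⁻ t, ENNReal.ofReal (‖charFun ν t‖ ^ 2) ≤ ENNReal.ofReal (2 * π) := by
  have hψm := measurable_sq_norm_charFun ν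
  -- let the variance `n + 1` of the Gaussian weight tend to infinity and apply Fatou's lemma
  let f : ℕ → ℝ → ℝ≥0∞ := fun n t ↦
    ENNReal.ofReal (‖charFun ν t‖ ^ 2 * Real.exp (-(t ^ 2 / (2 * ((n + 1 : ℝ≥0) : ℝ)))))
  have hlim : ∀ t, Tendsto (fun n ↦ f n t) atTop (𝓝 (ENNReal.ofReal (‖charFun ν t‖ ^ 2))) := by
    intro t
    refine ENNReal.tendsto_ofReal ?_
    have h1 : Tendsto (fun n : ℕ ↦ t ^ 2 / 2 * (1 / ((n : ℝ) + 1))) atTop (𝓝 (t ^ 2 / 2 * 0)) :=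
      tendsto_one_div_add_atTop_nhds_zero_nat.const_mul _
    have h2 := (Real.continuous_exp.tendsto _).comp h1.neg
    have h3 := h2.const_mul (‖charFun ν t‖ ^ 2)
    simp only [mul_zero, neg_zero, Real.exp_zero, mul_one] at h3
    refine h3.congr fun n ↦ ?_
    simp only [Function.comp_apply]
    congr 3
    push_cast
    field_simp
  calc _ = ∫⁻ t, liminf (fun n ↦ f n t) atTop := by
        congr 1 with t
        exact (hlim t).liminf_eq.symm
    _ ≤ liminf (fun n ↦ ∫⁻ t, f n t) atTop := by
        refine lintegral_liminf_le fun n ↦ ?_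
        exact (hψm.mul (by fun_prop)).ennreal_ofReal
    _ ≤ ENNReal.ofReal (2 * π) := by
        refine liminf_le_of_le (by isBoundedDefault) fun b hb ↦ ?_
        obtain ⟨n, hn⟩ := hb.exists
        exact hn.trans (lintegral_sq_norm_charFun_mul_exp_le h (by positivity))

/-! ### Decay of characteristic functions -/

/-- Away from the origin the characteristic function stays away from `1` in modulus. If `ψ = |φ|²`
were close to `1` at `t`, then it would be at least `3 / 4` at `k * t` for all `k < 256`, hence at
least `1 / 2` on disjoint intervals of total length `16`, which is too much for `∫ ψ ≤ 2 * π`. -/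
theorem sq_norm_charFun_le_of_le {ν : Measure ℝ} [IsProbabilityMeasure ν]
    (h : ν ≤ volume) (hR : ∀ᵐ x ∂ν, |x| ≤ 2) {t : ℝ} (ht : 1 / 16 ≤ t) :
    ‖charFun ν t‖ ^ 2 ≤ 1 - 1 / 2 ^ 18 := by
  by_contra! hcon
  have hlow : ∀ k ∈ Finset.range 256, ∀ s ∈ Set.Ioc (k * t) (k * t + 1 / 16),
      1 / 2 ≤ ‖charFun ν s‖ ^ 2 := by
    intro k hk s hs
    have hk' : (k : ℝ) ≤ 256 := by exact_mod_cast (Finset.mem_range.1 hk).le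
    have h1 := one_sub_sq_norm_charFun_nat_mul_le ν k t
    have h2 : (k : ℝ) ^ 2 * (1 - ‖charFun ν t‖ ^ 2) ≤ 256 ^ 2 * (1 / 2 ^ 18) := by
      have := sq_norm_charFun_le_one ν t
      gcongr
      linarith
    have h3 := abs_sq_norm_charFun_sub_le hR s (k * t)
    have h4 : |s - k * t| ≤ 1 / 16 := abs_le.2 ⟨by linarith [hs.1], by linarith [hs.2]⟩
    have h5 := (abs_le.1 h3).1
    norm_num at h2
    linarith
  have hdisj : Set.PairwiseDisjoint (↑(Finset.range 256))
      fun k : ℕ ↦ Set.Ioc (k * t) (k * t + 1 / 16) := by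
    have key : ∀ i j : ℕ, i < j →
        Disjoint (Set.Ioc (i * t) (i * t + 1 / 16)) (Set.Ioc (j * t) (j * t + 1 / 16)) := by
      intro i j hij
      refine Set.disjoint_left.2 fun s hs hs' ↦ ?_
      have : (i : ℝ) + 1 ≤ j := by exact_mod_cast hij
      have : ((i : ℝ) + 1) * t ≤ j * t := by gcongr
      linarith [hs.2, hs'.1]
    intro i _ j _ hij
    rcases lt_or_gt_of_ne hij with hlt | hlt
    · exact key i j hlt
    · exact (key j i hlt).symm
  have hge : ENNReal.ofReal 8 ≤ ENNReal.ofReal (2 * π) := by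
    calc ENNReal.ofReal 8
        = ∑ k ∈ Finset.range 256, ENNReal.ofReal (1 / 2) *
            volume (Set.Ioc ((k : ℝ) * t) (k * t + 1 / 16)) := by
          simp only [Real.volume_Ioc, add_sub_cancel_left, Finset.sum_const, Finset.card_range,
            nsmul_eq_mul]
          rw [← ENNReal.ofReal_mul (by norm_num), ← ENNReal.ofReal_natCast,
            ← ENNReal.ofReal_mul (by norm_num)]
          norm_num
      _ ≤ ∑ k ∈ Finset.range 256, ∫⁻ s in Set.Ioc ((k : ℝ) * t) (k * t + 1 / 16),
            ENNReal.ofReal (‖charFun ν s‖ ^ 2) := by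
          refine Finset.sum_le_sum fun k hk ↦ ?_
          rw [← setLIntegral_const]
          exact setLIntegral_mono' measurableSet_Ioc fun s hs ↦
            ENNReal.ofReal_le_ofReal (hlow k hk s hs)
      _ = ∫⁻ s in ⋃ k ∈ Finset.range 256, Set.Ioc ((k : ℝ) * t) (k * t + 1 / 16),
            ENNReal.ofReal (‖charFun ν s‖ ^ 2) :=
          (lintegral_biUnion_finset hdisj (fun _ _ ↦ measurableSet_Ioc) _).symm
      _ ≤ ∫⁻ s, ENNReal.ofReal (‖charFun ν s‖ ^ 2) := setLIntegral_le_lintegral _ _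
      _ ≤ _ := lintegral_sq_norm_charFun_le h
  have := (ENNReal.ofReal_le_ofReal_iff (by positivity)).1 hge
  linarith [Real.pi_lt_d2]

/-- Near the origin the characteristic function decays at least quadratically, because some
multiple of `t` lands where `sq_norm_charFun_le_of_le` applies. -/
theorem sq_norm_charFun_le_of_lt {ν : Measure ℝ} [IsProbabilityMeasure ν]
    (h : ν ≤ volume) (hR : ∀ᵐ x ∂ν, |x| ≤ 2) {t : ℝ} (ht0 : 0 < t) (ht : t < 1 / 16) :
    ‖charFun ν t‖ ^ 2 ≤ 1 - t ^ 2 / 2 ^ 12 := by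
  -- the least `k` with `k * t ≥ 1 / 16`, for which still `k * t ≤ 1 / 8`
  set k := ⌈1 / 16 / t⌉₊ with hk
  have h1 : 1 / 16 / t ≤ k := Nat.le_ceil _
  have h2 : (k : ℝ) < 1 / 16 / t + 1 := Nat.ceil_lt_add_one (by positivity)
  have h3 : 1 / 16 ≤ k * t := by rwa [div_le_iff₀ ht0] at h1
  have h4 : k * t ≤ 1 / 8 := by
    have : (k : ℝ) * t ≤ (1 / 16 / t + 1) * t := by gcongr
    rw [add_mul, div_mul_cancel₀ _ ht0.ne'] at this
    linarith
  have h5 := one_sub_sq_norm_charFun_nat_mul_le ν k t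
  have h6 := sq_norm_charFun_le_of_le h hR h3
  have h7 : (k * t) ^ 2 ≤ (1 / 8) ^ 2 := by gcongr
  have hu : 0 ≤ 1 - ‖charFun ν t‖ ^ 2 := by linarith [sq_norm_charFun_le_one ν t]
  have h8 : (k * t) ^ 2 * (1 - ‖charFun ν t‖ ^ 2) ≤ (1 / 8) ^ 2 * (1 - ‖charFun ν t‖ ^ 2) := by
    gcongr
  have h9 : t ^ 2 * (1 / 2 ^ 18) ≤ t ^ 2 * (k ^ 2 * (1 - ‖charFun ν t‖ ^ 2)) := by
    gcongr; linarith
  norm_num at h8 h9 ⊢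
  linarith

theorem rpow_le_exp_of_le_one_sub {x y q : ℝ} (hx : 0 ≤ x) (h : x ≤ 1 - y) (hq : 0 ≤ q) :
    x ^ q ≤ Real.exp (-(y * q)) := by
  have h1 : x ≤ Real.exp (-y) := h.trans (by linarith [Real.add_one_le_exp (-y)])
  calc x ^ q ≤ Real.exp (-y) ^ q := Real.rpow_le_rpow hx h1 hq
    _ = _ := by rw [← Real.exp_mul]; ring_nf

/-- For `|t| < 1 / 16` the quadratic gap gives the Gaussian term; for `|t| ≥ 1 / 16` all but one of
the `q` factors are spent on the constant gap, and the remaining one keeps integrability. -/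
theorem sq_norm_charFun_rpow_le {ν : Measure ℝ} [IsProbabilityMeasure ν]
    (h : ν ≤ volume) (hR : ∀ᵐ x ∂ν, |x| ≤ 2) {q : ℝ} (hq : 1 ≤ q) (t : ℝ) :
    (‖charFun ν t‖ ^ 2) ^ q ≤ Real.exp (-(q / 2 ^ 12) * t ^ 2) +
      Real.exp (-(1 / 2 ^ 18 * (q - 1))) * ‖charFun ν t‖ ^ 2 := by
  wlog ht : 0 ≤ t generalizing t
  · have := this (-t) (by linarith)
    simpa [charFun_neg] using this
  have h0 : 0 ≤ ‖charFun ν t‖ ^ 2 := by positivity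
  rcases ht.eq_or_lt with rfl | ht
  · have : (‖charFun ν 0‖ ^ 2) ^ q ≤ 1 :=
      Real.rpow_le_one h0 (sq_norm_charFun_le_one ν 0) (by linarith)
    have h2 : 0 ≤ Real.exp (-(1 / 2 ^ 18 * (q - 1))) * ‖charFun ν 0‖ ^ 2 := by positivity
    rw [zero_pow two_ne_zero, mul_zero, Real.exp_zero]
    linarith
  rcases lt_or_ge t (1 / 16) with h16 | h16
  · have h1 := rpow_le_exp_of_le_one_sub h0 (sq_norm_charFun_le_of_lt h hR ht h16)
      (q := q) (by linarith)
    have h2 : 0 ≤ Real.exp (-(1 / 2 ^ 18 * (q - 1))) * ‖charFun ν t‖ ^ 2 := by positivity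
    rw [show -(q / 2 ^ 12) * t ^ 2 = -(t ^ 2 / 2 ^ 12 * q) by ring]
    linarith
  · have h1 := rpow_le_exp_of_le_one_sub h0 (sq_norm_charFun_le_of_le h hR h16)
      (q := q - 1) (by linarith)
    have h2 := Real.exp_pos (-(q / 2 ^ 12) * t ^ 2)
    have h3 : (‖charFun ν t‖ ^ 2) ^ q = (‖charFun ν t‖ ^ 2) ^ (q - 1) * ‖charFun ν t‖ ^ 2 := by
      conv_lhs => rw [show q = (q - 1) + 1 by ring,
        Real.rpow_add_of_nonneg h0 (by linarith) zero_le_one, Real.rpow_one]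
    rw [h3]
    have := mul_le_mul_of_nonneg_right h1 h0
    linarith

/-! ### Integrals of powers -/

/-- The constant in the bound `∫ |φ| ^ (2 * q) ≤ charFunConst / √q`. -/
noncomputable def charFunConst : ℝ := √(π * 2 ^ 12) + 2 ^ 9 * (2 * π)

theorem exp_neg_le_div_sqrt {q : ℝ} (hq : 1 ≤ q) :
    Real.exp (-(1 / 2 ^ 18 * (q - 1))) ≤ 2 ^ 9 / √q := by
  set y : ℝ := 1 / 2 ^ 18 * (q - 1) with hy
  have h1 : √q ≤ 2 ^ 9 * Real.exp y := by
    refine Real.sqrt_le_iff.2 ⟨by positivity, ?_⟩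
    rw [mul_pow, ← Real.exp_nat_mul]
    have := Real.add_one_le_exp ((2 : ℕ) * y)
    push_cast at this ⊢
    rw [hy] at this ⊢
    linarith
  rw [Real.exp_neg, le_div_iff₀ (by positivity), inv_mul_le_iff₀ (Real.exp_pos _)]
  linarith

/-- The estimate of K. Ball's type on which the argument rests: high powers of the modulus of
the characteristic function have the same integrals as a Gaussian, up to a constant. -/
theorem lintegral_sq_norm_charFun_rpow_le {ν : Measure ℝ} [IsProbabilityMeasure ν]
    (h : ν ≤ volume) (hR : ∀ᵐ x ∂ν, |x| ≤ 2) {q : ℝ} (hq : 1 ≤ q) :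
    ∫⁻ t, ENNReal.ofReal ((‖charFun ν t‖ ^ 2) ^ q) ≤ ENNReal.ofReal (charFunConst / √q) := by
  have hq0 : 0 < q := by linarith
  calc _ ≤ ∫⁻ t, (ENNReal.ofReal (Real.exp (-(q / 2 ^ 12) * t ^ 2)) +
        ENNReal.ofReal (2 ^ 9 / √q) * ENNReal.ofReal (‖charFun ν t‖ ^ 2)) := by
        refine lintegral_mono fun t ↦ ?_
        rw [← ENNReal.ofReal_mul (by positivity),
          ← ENNReal.ofReal_add (by positivity) (by positivity)]
        refine ENNReal.ofReal_le_ofReal ((sq_norm_charFun_rpow_le h hR hq t).trans ?_)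
        gcongr
        exact exp_neg_le_div_sqrt hq
    _ ≤ ENNReal.ofReal (√(π / (q / 2 ^ 12))) +
        ENNReal.ofReal (2 ^ 9 / √q) * ENNReal.ofReal (2 * π) := by
        rw [lintegral_add_left (by fun_prop), lintegral_const_mul' _ _ ENNReal.ofReal_ne_top]
        gcongr
        · rw [← ofReal_integral_eq_lintegral_ofReal
            (integrable_exp_neg_mul_sq (by positivity)) (ae_of_all _ fun t ↦ (Real.exp_pos _).le),
            integral_gaussian]
        · exact lintegral_sq_norm_charFun_le h
    _ = _ := by
        rw [← ENNReal.ofReal_mul (by positivity),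
          ← ENNReal.ofReal_add (by positivity) (by positivity), charFunConst,
          show π / (q / 2 ^ 12) = π * 2 ^ 12 / q by field_simp, Real.sqrt_div (by positivity)]
        congr 1
        ring

/-! ### Concentration via characteristic functions -/

/-- An Esseen-type concentration inequality, obtained by comparing the indicator of the interval
with a Gaussian of the same width. -/
theorem measure_abs_sub_le_lintegral_charFun (ν : Measure ℝ) [IsProbabilityMeasure ν] (a : ℝ)
    {ε : ℝ} (hε : 0 < ε) :
    ν {x | |x - a| ≤ ε} ≤ ENNReal.ofReal ε * ∫⁻ t, ‖charFun ν t‖ₑ := by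
  set ν' := ν.map (· + -a) with hν'
  have : IsProbabilityMeasure ν' := Measure.isProbabilityMeasure_map (by fun_prop)
  have hnorm : ∀ t, ‖charFun ν' t‖ₑ = ‖charFun ν t‖ₑ := by
    intro t
    rw [hν', charFun_map_add_const, enorm_mul]
    have : ‖Complex.exp (inner ℝ (-a) t * Complex.I)‖ₑ = 1 := by
      rw [← ofReal_norm, Complex.norm_exp_ofReal_mul_I, ENNReal.ofReal_one]
    rw [this, mul_one]
  -- the Gaussian `exp (-v * x ^ 2 / 2)` is at least `exp (-1 / 2)` for `|x| ≤ ε`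
  set v : ℝ≥0 := ⟨1 / ε ^ 2, by positivity⟩ with hv
  have hvε : (v : ℝ) = 1 / ε ^ 2 := rfl
  have hv0 : v ≠ 0 := by
    rw [← NNReal.coe_ne_zero, hvε]; positivity
  have hint : Integrable (fun x : ℝ ↦ Real.exp (-(v * x ^ 2 / 2))) ν' :=
    Integrable.of_bound (by fun_prop) 1 (ae_of_all _ fun x ↦ by
      rw [Real.norm_of_nonneg (Real.exp_pos _).le, Real.exp_le_one_iff]
      have : 0 ≤ v * x ^ 2 / 2 := by positivity
      linarith)
  have h1 : ν {x | |x - a| ≤ ε} = ν' {x | |x| ≤ ε} := by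
    rw [hν', Measure.map_apply (by fun_prop) (measurableSet_le (by fun_prop) (by fun_prop))]
    simp [sub_eq_add_neg]
  have h2 : ENNReal.ofReal (Real.exp (-(1 / 2))) * ν' {x | |x| ≤ ε} ≤
      ∫⁻ x, ENNReal.ofReal (Real.exp (-(v * x ^ 2 / 2))) ∂ν' := by
    refine le_trans (mul_le_mul_right (measure_mono fun x hx ↦ ?_) _)
      (mul_meas_ge_le_lintegral (by fun_prop) (ENNReal.ofReal (Real.exp (-(1 / 2)))))
    refine ENNReal.ofReal_le_ofReal (Real.exp_le_exp.2 ?_)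
    have hx2 : x ^ 2 ≤ ε ^ 2 := sq_le_sq' (abs_le.1 hx).1 (abs_le.1 hx).2
    have : 1 / ε ^ 2 * x ^ 2 ≤ 1 := by
      rw [one_div, inv_mul_le_iff₀ (by positivity)]; linarith
    rw [hvε]
    linarith
  have h3 : ∫⁻ x, ENNReal.ofReal (Real.exp (-(v * x ^ 2 / 2))) ∂ν' ≤
      ENNReal.ofReal (ε / √(2 * π)) * ∫⁻ t, ‖charFun ν t‖ₑ := by
    rw [← ofReal_integral_eq_lintegral_ofReal hint (ae_of_all _ fun x ↦ (Real.exp_pos _).le)]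
    have hpars := integral_charFun_gaussianReal ν' v
    have hnn : 0 ≤ ∫ x, Real.exp (-(v * x ^ 2 / 2)) ∂ν' :=
      integral_nonneg fun x ↦ (Real.exp_pos _).le
    calc ENNReal.ofReal (∫ x, Real.exp (-(v * x ^ 2 / 2)) ∂ν')
        = ‖∫ t, charFun ν' t ∂gaussianReal 0 v‖ₑ := by
          rw [hpars, ← ofReal_norm, Complex.norm_real, Real.norm_of_nonneg hnn]
      _ ≤ ∫⁻ t, ‖charFun ν' t‖ₑ ∂gaussianReal 0 v := enorm_integral_le_lintegral_enorm _
      _ = ∫⁻ t, gaussianPDF 0 v t * ‖charFun ν t‖ₑ := by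
          simp_rw [hnorm]
          rw [gaussianReal_of_var_ne_zero _ hv0, lintegral_withDensity_eq_lintegral_mul _
            (measurable_gaussianPDF _ _) measurable_charFun.enorm]
          rfl
      _ ≤ ∫⁻ t, ENNReal.ofReal (ε / √(2 * π)) * ‖charFun ν t‖ₑ := by
          refine lintegral_mono fun t ↦ ?_
          refine mul_le_mul_left (ENNReal.ofReal_le_ofReal ?_) _
          have hs : √(2 * π * v) = √(2 * π) / ε := by
            rw [hvε, mul_one_div, Real.sqrt_div (by positivity), Real.sqrt_sq hε.le]
          rw [gaussianPDFReal, hs, inv_div]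
          refine mul_le_of_le_one_right (by positivity) (Real.exp_le_one_iff.2 ?_)
          rw [neg_div]
          exact neg_nonpos.2 (by positivity)
      _ = _ := lintegral_const_mul' _ _ ENNReal.ofReal_ne_top
  have h4 : Real.exp (1 / 2) ≤ √(2 * π) := by
    refine Real.le_sqrt_of_sq_le ?_
    rw [← Real.exp_nat_mul]
    norm_num
    linarith [Real.exp_one_lt_d9, Real.pi_gt_three]
  calc ν {x | |x - a| ≤ ε}
      = ENNReal.ofReal (Real.exp (1 / 2)) *
          (ENNReal.ofReal (Real.exp (-(1 / 2))) * ν' {x | |x| ≤ ε}) := by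
        rw [← mul_assoc, ← ENNReal.ofReal_mul (Real.exp_pos _).le, ← Real.exp_add, h1]
        simp
    _ ≤ ENNReal.ofReal (Real.exp (1 / 2)) *
          (ENNReal.ofReal (ε / √(2 * π)) * ∫⁻ t, ‖charFun ν t‖ₑ) := by
        exact mul_le_mul_right (h2.trans h3) _
    _ ≤ _ := by
        rw [← mul_assoc, ← ENNReal.ofReal_mul (Real.exp_pos _).le]
        gcongr
        rw [mul_div_assoc', div_le_iff₀ (by positivity), mul_comm]
        gcongr

theorem lintegral_comp_mul_left_eq {f : ℝ → ℝ≥0∞} (hf : Measurable f) {c : ℝ} (hc : c ≠ 0) :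
    ∫⁻ t, f (c * t) = ENNReal.ofReal |c|⁻¹ * ∫⁻ t, f t := by
  rw [← lintegral_map hf (by fun_prop), Real.map_volume_mul_left hc, lintegral_smul_measure,
    abs_inv, smul_eq_mul]

/-- Hölder's inequality with exponents `s ^ 2 / c i ^ 2` makes every factor contribute the same
bound `1 / s`. The condition on `c i` keeps these exponents at least `2`. -/
theorem lintegral_prod_charFun_le {ι : Type*} [Fintype ι] {ν : ι → Measure ℝ}
    [∀ i, IsProbabilityMeasure (ν i)] (h : ∀ i, ν i ≤ volume) (hR : ∀ i, ∀ᵐ x ∂ν i, |x| ≤ 2)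
    {c : ι → ℝ} {s : ℝ} (hs : 0 < s) (hsum : ∑ i, c i ^ 2 = s ^ 2)
    (hc : ∀ i, 2 * c i ^ 2 ≤ s ^ 2) :
    ∫⁻ t, ∏ i, ‖charFun (ν i) (c i * t)‖ₑ ≤ ENNReal.ofReal (charFunConst * √2 / s) := by
  set w : ι → ℝ := fun i ↦ c i ^ 2 / s ^ 2 with hw
  have hw0 : ∀ i, 0 ≤ w i := fun i ↦ by positivity
  have hw1 : ∑ i, w i = 1 := by
    rw [← Finset.sum_div, hsum, div_self (by positivity)]
  have hK : 0 < charFunConst := by unfold charFunConst; positivity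
  set f : ι → ℝ → ℝ≥0∞ := fun i t ↦
    ENNReal.ofReal ((‖charFun (ν i) (c i * t)‖ ^ 2) ^ (1 / (2 * w i)))
  have hψm : ∀ i, Measurable fun t ↦
      ENNReal.ofReal ((‖charFun (ν i) t‖ ^ 2) ^ (1 / (2 * w i))) := fun i ↦
    ((measurable_sq_norm_charFun (ν i)).pow_const _).ennreal_ofReal
  have hfm : ∀ i, Measurable (f i) := fun i ↦
    (hψm i).comp (measurable_const_mul (c i))
  have hfac : ∀ i t, ‖charFun (ν i) (c i * t)‖ₑ = f i t ^ w i := by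
    intro i t
    -- for `c i = 0` the exponent `1 / (2 * w i)` is `1 / 0 = 0`, and both sides are `1`
    rcases eq_or_ne (c i) 0 with h0 | h0
    · simp [f, w, h0]
    have hwi : 0 < w i := by positivity
    rw [← ofReal_norm, ENNReal.ofReal_rpow_of_nonneg (by positivity) (hw0 i),
      ← Real.rpow_mul (by positivity), ← Real.rpow_natCast, ← Real.rpow_mul (norm_nonneg _)]
    congr 1
    rw [show ((2 : ℕ) : ℝ) * (1 / (2 * w i) * w i) = 1 by push_cast; field_simp, Real.rpow_one]
  have hint : ∀ i, (∫⁻ t, f i t) ^ w i ≤ ENNReal.ofReal ((charFunConst * √2 / s) ^ w i) := by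
    intro i
    -- for `c i = 0` the integral is infinite, but its exponent `w i` is `0`
    rcases eq_or_ne (c i) 0 with h0 | h0
    · simp [w, h0]
    have hwi : 0 < w i := by positivity
    have hq : 1 ≤ 1 / (2 * w i) := by
      rw [le_div_iff₀ (by positivity), one_mul]
      have : w i = c i ^ 2 / s ^ 2 := rfl
      rw [this, mul_div_assoc', div_le_one (by positivity)]
      exact hc i
    rw [← ENNReal.ofReal_rpow_of_nonneg (by positivity) (hw0 i)]
    refine ENNReal.rpow_le_rpow ?_ (hw0 i)
    calc ∫⁻ t, f i t
        = ENNReal.ofReal |c i|⁻¹ *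
            ∫⁻ t, ENNReal.ofReal ((‖charFun (ν i) t‖ ^ 2) ^ (1 / (2 * w i))) :=
          lintegral_comp_mul_left_eq (hψm i) h0
      _ ≤ ENNReal.ofReal |c i|⁻¹ * ENNReal.ofReal (charFunConst / √(1 / (2 * w i))) := by
          gcongr
          exact lintegral_sq_norm_charFun_rpow_le (h i) (hR i) hq
      _ = _ := by
          rw [← ENNReal.ofReal_mul (by positivity)]
          congr 1
          have hsq : √(1 / (2 * w i)) = s / (√2 * |c i|) := by
            rw [show 1 / (2 * w i) = s ^ 2 / (2 * c i ^ 2) by simp only [hw]; field_simp,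
              Real.sqrt_div (by positivity), Real.sqrt_sq hs.le,
              Real.sqrt_mul (by norm_num), Real.sqrt_sq_eq_abs]
          rw [hsq]
          have := abs_pos.2 h0
          field_simp
  calc ∫⁻ t, ∏ i, ‖charFun (ν i) (c i * t)‖ₑ = ∫⁻ t, ∏ i, f i t ^ w i := by simp_rw [hfac]
    _ ≤ ∏ i, (∫⁻ t, f i t) ^ w i :=
        ENNReal.lintegral_prod_norm_pow_le _ (fun i _ ↦ (hfm i).aemeasurable) hw1
          fun i _ ↦ hw0 i
    _ ≤ ∏ i, ENNReal.ofReal ((charFunConst * √2 / s) ^ w i) := Finset.prod_le_prod' fun i _ ↦ hint i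
    _ = _ := by
        rw [← ENNReal.ofReal_prod_of_nonneg fun i _ ↦ by positivity,
          ← Real.rpow_sum_of_pos (by positivity), hw1, Real.rpow_one]

/-- A summand with bounded density spreads the whole sum, by conditioning on the other summand. -/
theorem measure_abs_mul_add_sub_le {Ω : Type*} [MeasurableSpace Ω] {μ : Measure Ω}
    [IsProbabilityMeasure μ] {X Y : Ω → ℝ} (hX : AEMeasurable X μ) (hY : AEMeasurable Y μ)
    (hXY : IndepFun X Y μ) (h : μ.map X ≤ volume) {c : ℝ} (hc : c ≠ 0) (a ε : ℝ) :
    μ {ω | |c * X ω + Y ω - a| ≤ ε} ≤ ENNReal.ofReal (2 * ε / |c|) := by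
  have : IsProbabilityMeasure (μ.map X) := Measure.isProbabilityMeasure_map hX
  have : IsProbabilityMeasure (μ.map Y) := Measure.isProbabilityMeasure_map hY
  have hS : MeasurableSet {p : ℝ × ℝ | |c * p.1 + p.2 - a| ≤ ε} :=
    measurableSet_le (by fun_prop) (by fun_prop)
  have hprod := (indepFun_iff_map_prod_eq_prod_map_map hX hY).1 hXY
  calc μ {ω | |c * X ω + Y ω - a| ≤ ε}
      = (μ.map fun ω ↦ (X ω, Y ω)) {p : ℝ × ℝ | |c * p.1 + p.2 - a| ≤ ε} := by
        rw [Measure.map_apply_of_aemeasurable (hX.prodMk hY) hS]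
        rfl
    _ = ∫⁻ y, μ.map X {x | |c * x + y - a| ≤ ε} ∂μ.map Y := by
        rw [hprod, Measure.prod_apply_symm hS]
        rfl
    _ ≤ ∫⁻ _, ENNReal.ofReal (2 * ε / |c|) ∂μ.map Y := by
        refine lintegral_mono fun y ↦ (h _).trans_eq ?_
        have hpre : {x | |c * x + y - a| ≤ ε} = (c * ·) ⁻¹' Metric.closedBall (a - y) ε := by
          ext x
          simp only [Set.mem_ofPred_eq, Set.mem_preimage, Metric.mem_closedBall, Real.dist_eq]
          ring_nf
        rw [hpre, Real.volume_preimage_mul_left hc, Real.volume_closedBall,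
          ← ENNReal.ofReal_mul (by positivity), abs_inv]
        congr 1
        ring
    _ = _ := by simp

/-! ### Linear combinations of nice random variables -/

namespace IsNice

variable {Ω : Type*} [MeasurableSpace Ω] {μ : Measure Ω} {X : Ω → ℝ}

theorem aemeasurable (h : IsNice X μ) : AEMeasurable X μ :=
  have := h.hasPDF
  HasPDF.aemeasurable X μ volume

theorem map_le_volume (h : IsNice X μ) : μ.map X ≤ volume := by
  have := h.hasPDF
  rw [map_eq_withDensity_pdf X μ volume]
  calc _ ≤ volume.withDensity 1 := withDensity_mono h.pdf_le_one
    _ = _ := withDensity_one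

theorem ae_map_abs_le (h : IsNice X μ) : ∀ᵐ x ∂μ.map X, |x| ≤ 2 := by
  rw [ae_map_iff h.aemeasurable (measurableSet_le (by fun_prop) (by fun_prop))]
  filter_upwards [h.mem_Icc] with ω hω using abs_le.2 hω

theorem hasSubgaussianMGF_const_mul [IsProbabilityMeasure μ] (h : IsNice X μ) (c : ℝ) :
    HasSubgaussianMGF (fun ω ↦ c * X ω) (4 * ‖c‖₊ ^ 2) μ := by
  have := (hasSubgaussianMGF_of_mem_Icc_of_integral_eq_zero h.aemeasurable h.mem_Icc
    h.mean_zero).const_mul c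
  have h4 : (‖(2 : ℝ) - -2‖₊ / 2) ^ 2 = 4 := by
    ext
    push_cast
    norm_num
  rw [h4] at this
  have hc : 4 * ‖c‖₊ ^ 2 = NNReal.mk (c ^ 2) (sq_nonneg c) * 4 := by
    ext
    rw [NNReal.coe_mul, NNReal.coe_mul, NNReal.coe_mk, NNReal.coe_pow, coe_nnnorm,
      Real.norm_eq_abs, sq_abs, mul_comm]
  rw [hc]
  exact this

end IsNice

section Sum

variable {Ω : Type*} [MeasurableSpace Ω] {μ : Measure Ω} [IsProbabilityMeasure μ]
  {ι : Type*} [Fintype ι] {x : ι → Ω → ℝ}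

/-- A linear combination has a density bounded by a constant over the `ℓ²` norm `s` of its
coefficients: if some coefficient exceeds `s / √2` that summand alone is spread enough, and
otherwise the characteristic function is integrable. -/
theorem measure_abs_sum_sub_le (hx : iIndepFun x μ) (hnice : ∀ i, IsNice (x i) μ) {c : ι → ℝ}
    {s : ℝ} (hs : 0 < s) (hsum : ∑ i, c i ^ 2 = s ^ 2) (a : ℝ) {ε : ℝ} (hε : 0 < ε) :
    μ {ω | |∑ i, c i * x i ω - a| ≤ ε} ≤ ENNReal.ofReal ((charFunConst + 2) * √2 * ε / s) := by
  classical
  have hK : 0 < charFunConst := by unfold charFunConst; positivity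
  have hmeas : ∀ i, AEMeasurable (fun ω ↦ c i * x i ω) μ := fun i ↦
    (hnice i).aemeasurable.const_mul _
  have hind : iIndepFun (fun i ω ↦ c i * x i ω) μ :=
    hx.comp (fun i y ↦ c i * y) fun i ↦ measurable_const_mul _
  by_cases hc : ∀ i, 2 * c i ^ 2 ≤ s ^ 2
  · have hL : AEMeasurable (fun ω ↦ ∑ i, c i * x i ω) μ :=
      Finset.aemeasurable_fun_sum _ fun i _ ↦ hmeas i
    have : IsProbabilityMeasure (μ.map fun ω ↦ ∑ i, c i * x i ω) :=
      Measure.isProbabilityMeasure_map hL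
    have : ∀ i, IsProbabilityMeasure (μ.map (x i)) := fun i ↦
      Measure.isProbabilityMeasure_map (hnice i).aemeasurable
    have hchar : ∀ t, ‖charFun (μ.map fun ω ↦ ∑ i, c i * x i ω) t‖ₑ =
        ∏ i, ‖charFun (μ.map (x i)) (c i * t)‖ₑ := by
      intro t
      rw [hind.charFun_map_fun_sum_eq_prod hmeas, Finset.prod_apply, ← ofReal_norm, norm_prod,
        ENNReal.ofReal_prod_of_nonneg fun i _ ↦ norm_nonneg _]
      refine Finset.prod_congr rfl fun i _ ↦ ?_
      rw [charFun_map_mul_comp (hnice i).aemeasurable, ofReal_norm]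
    calc μ {ω | |∑ i, c i * x i ω - a| ≤ ε}
        = (μ.map fun ω ↦ ∑ i, c i * x i ω) {y | |y - a| ≤ ε} := by
          rw [Measure.map_apply_of_aemeasurable hL
            (measurableSet_le (by fun_prop) (by fun_prop))]
          rfl
      _ ≤ ENNReal.ofReal ε * ENNReal.ofReal (charFunConst * √2 / s) := by
          refine (measure_abs_sub_le_lintegral_charFun _ a hε).trans ?_
          simp_rw [hchar]
          gcongr
          exact lintegral_prod_charFun_le (fun i ↦ (hnice i).map_le_volume)
            (fun i ↦ (hnice i).ae_map_abs_le) hs hsum hc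
      _ ≤ _ := by
          rw [← ENNReal.ofReal_mul hε.le, mul_div_assoc']
          refine ENNReal.ofReal_le_ofReal ?_
          gcongr ?_ / s
          nlinarith [mul_pos (Real.sqrt_pos.2 (zero_lt_two (α := ℝ))) hε]
  · push Not at hc
    obtain ⟨i, hi⟩ := hc
    have hci : s / √2 ≤ |c i| := by
      rw [div_le_iff₀ (by positivity)]
      refine abs_le_of_sq_le_sq' ?_ (by positivity) |>.2
      rw [mul_pow, sq_abs, Real.sq_sqrt (by norm_num)]
      linarith
    have hci0 : 0 < |c i| := lt_of_lt_of_le (by positivity) hci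
    have hrest : AEMeasurable (fun ω ↦ ∑ j ∈ Finset.univ.erase i, c j * x j ω) μ :=
      Finset.aemeasurable_fun_sum _ fun j _ ↦ hmeas j
    have hindep : IndepFun (x i) (fun ω ↦ ∑ j ∈ Finset.univ.erase i, c j * x j ω) μ := by
      have h1 := (hind.indepFun_finsetSum_of_notMem₀ hmeas
        (Finset.notMem_erase i Finset.univ)).symm
      have h2 := h1.comp (φ := fun y ↦ (c i)⁻¹ * y) (ψ := id) (by fun_prop) measurable_id
      convert h2 using 1
      · ext ω
        simp [inv_mul_cancel_left₀ (abs_pos.1 hci0)]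
      · ext ω
        simp
    calc μ {ω | |∑ i, c i * x i ω - a| ≤ ε}
        = μ {ω | |c i * x i ω + ∑ j ∈ Finset.univ.erase i, c j * x j ω - a| ≤ ε} := by
          congr 1 with ω
          rw [Set.mem_ofPred_eq, Set.mem_ofPred_eq,
            Finset.add_sum_erase _ (fun j ↦ c j * x j ω) (Finset.mem_univ i)]
      _ ≤ ENNReal.ofReal (2 * ε / |c i|) :=
          measure_abs_mul_add_sub_le (hnice i).aemeasurable hrest hindep
            (hnice i).map_le_volume (abs_pos.1 hci0) a ε
      _ ≤ _ := by
          refine ENNReal.ofReal_le_ofReal ?_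
          calc 2 * ε / |c i| ≤ 2 * ε / (s / √2) := by gcongr
            _ = 2 * √2 * ε / s := by field_simp
            _ ≤ _ := by gcongr; linarith

/-- Hoeffding's inequality for linear combinations, on the event that the sum is near `1`. -/
theorem measureReal_abs_sum_sub_one_le (hx : iIndepFun x μ) (hnice : ∀ i, IsNice (x i) μ)
    {c : ι → ℝ} {s : ℝ} (hsum : ∑ i, c i ^ 2 = s ^ 2) {ε : ℝ} (hε : ε < 1 / 2) :
    μ.real {ω | |∑ i, c i * x i ω - 1| ≤ ε} ≤ Real.exp (-(1 / (32 * s ^ 2))) := by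
  have hind : iIndepFun (fun i ω ↦ c i * x i ω) μ :=
    hx.comp (fun i y ↦ c i * y) fun i ↦ measurable_const_mul _
  have h := HasSubgaussianMGF.measure_sum_ge_le_of_iIndepFun hind (s := Finset.univ)
    (fun i _ ↦ (hnice i).hasSubgaussianMGF_const_mul (c i)) (ε := 1 / 2) (by norm_num)
  calc _ ≤ μ.real {ω | 1 / 2 ≤ ∑ i, c i * x i ω} := by
        refine measureReal_mono fun ω hω ↦ ?_
        rw [Set.mem_ofPred_eq] at hω
        have := (abs_le.1 hω).1
        simp only [Set.mem_ofPred_eq]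
        linarith
    _ ≤ _ := h
    _ = _ := by
        push_cast
        simp_rw [Real.norm_eq_abs, sq_abs]
        rw [← Finset.mul_sum, hsum]
        congr 1
        ring

end Sum

theorem mainTheorem6 :
    ∃ C : ℝ, 1.2 < C ∧
      ∀ (Ω : Type*) [MeasurableSpace Ω] (μ : Measure Ω) [IsProbabilityMeasure μ]
        (n : ℕ) (x : Fin n → Ω → ℝ) (c : Fin n → ℝ),
        iIndepFun x μ → (∀ i, IsNice (x i) μ) →
        ∀ ε : ℝ, 0 < ε → ε < 1 / 2 →
          μ.real {ω | |(∑ i, c i * x i ω) - 1| ≤ ε} ≤ C * ε * √(Real.logb 2 (1 / ε)) := by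
  have hK : 0 < charFunConst := by unfold charFunConst; positivity
  set A : ℝ := (charFunConst + 2) * √2 * √32 with hA
  have hA0 : 0 < A := by positivity
  refine ⟨2 + A, by norm_num; linarith, ?_⟩
  intro Ω _ μ _ n x c hx hnice ε hε hε2
  set l := Real.log (1 / ε) with hl
  have hinv : 2 < 1 / ε := by rw [lt_div_iff₀ hε]; linarith
  have hl0 : 0 < l := Real.log_pos (by linarith)
  have hlb : l ≤ Real.logb 2 (1 / ε) := by
    rw [Real.logb, le_div_iff₀ (Real.log_pos one_lt_two)]
    exact mul_le_of_le_one_right hl0.le (by linarith [Real.log_two_lt_d9])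
  have h1b : 1 ≤ √(Real.logb 2 (1 / ε)) := by
    rw [Real.one_le_sqrt, Real.le_logb_iff_rpow_le one_lt_two (by linarith), Real.rpow_one]
    exact hinv.le
  have hR : 0 ≤ A * ε * √(Real.logb 2 (1 / ε)) := by positivity
  set s := √(∑ i, c i ^ 2) with hs
  have hsum : ∑ i, c i ^ 2 = s ^ 2 :=
    (Real.sq_sqrt (Finset.sum_nonneg fun i _ ↦ sq_nonneg _)).symm
  have hs0 : 0 ≤ s := Real.sqrt_nonneg _
  -- if `s = 0` the sum vanishes identically, and `1` is not within `1 / 2` of `0`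
  rcases hs0.eq_or_lt with h0 | h0
  · have hc : ∀ i, c i = 0 := by
      rw [← h0, zero_pow two_ne_zero,
        Finset.sum_eq_zero_iff_of_nonneg fun i _ ↦ sq_nonneg _] at hsum
      exact fun i ↦ by simpa using hsum i (Finset.mem_univ i)
    have hempty : {ω | |(∑ i, c i * x i ω) - 1| ≤ ε} = ∅ := by
      ext ω
      simp only [hc, zero_mul, Finset.sum_const_zero, Set.mem_ofPred_eq, Set.mem_empty_iff_false,
        iff_false, not_le]
      norm_num
      linarith
    rw [hempty, measureReal_empty]
    positivity
  -- the value of `s` at which Hoeffding's bound `exp (-1 / (32 * s ^ 2))` equals `ε`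
  by_cases hsmall : l ≤ 1 / (32 * s ^ 2)
  · calc _ ≤ Real.exp (-(1 / (32 * s ^ 2))) := measureReal_abs_sum_sub_one_le hx hnice hsum hε2
      _ ≤ Real.exp (-l) := by gcongr
      _ = ε := by rw [hl, one_div, Real.log_inv, neg_neg, Real.exp_log hε]
      _ ≤ _ := by nlinarith
  · push Not at hsmall
    have hsinv : 1 / s ≤ √32 * √(Real.logb 2 (1 / ε)) := by
      rw [← Real.sqrt_mul (by norm_num)]
      refine Real.le_sqrt_of_sq_le ?_
      rw [div_lt_iff₀ (by positivity)] at hsmall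
      rw [div_pow, one_pow, div_le_iff₀ (by positivity)]
      nlinarith [sq_nonneg s]
    have hbound := measure_abs_sum_sub_le hx hnice h0 hsum 1 hε
    calc _ ≤ (charFunConst + 2) * √2 * ε / s :=
          ENNReal.toReal_le_of_le_ofReal (by positivity) hbound
      _ = (charFunConst + 2) * √2 * ε * (1 / s) := by ring
      _ ≤ (charFunConst + 2) * √2 * ε * (√32 * √(Real.logb 2 (1 / ε))) := by gcongr
      _ = A * ε * √(Real.logb 2 (1 / ε)) := by rw [hA]; ring
      _ ≤ _ := by
          gcongr
          linarith
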